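/- For $x\in(0,1)$ let $\langle d_1(x),d_2(x),\dots\rangle$ be the Engel series expansion of $x$: with $T(0)=0$ and $T(x)=x\lceil 1/x\rceil-1$ for $x\in(0,1)$, put $d_1(x)=\lceil 1/x\rceil$ and $d_{n+1}(x)=d_1(T^n(x))$ for $n\ge 1$ (the expansion is finite if $T^k(x)=0$ for some $k$, and infinite otherwise). **Theorem.** Let $\phi:\{1,2,3,\dots\}\to(0,\infty)$ be a non-decreasing function with $\phi(n)/\log n\to\infty$ as $n\to\infty$, and let $$\Lambda_\phi=\Big\{x\in(0,1):\ \text{the Engel expansion of } x \text{ is infinite and } \liminf_{n\to\infty}\frac{\log d_n(x)}{\phi(n)}=1\Big\}.$$ Then $$\dim_{\rm H}\Lambda_\phi=\frac1A,$$ where $\dim_{\rm H}$ is the Hausdorff dimension and $A\in[1,\infty]$ is defined by $$\log A=\limsup_{n\to\infty}\frac{\log\phi(n)}{n},$$ with the conventions $\log\infty=\infty$ and $1/\infty=0$. -/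

import Mathlib

open Set Filter Topology
open scoped ENNReal

noncomputable section

/-- The Engel series map `T : [0,1) → [0,1)`, with `T 0 = 0` and `T x = x * ⌈1/x⌉ - 1`
for `x ∈ (0,1)` (only the values on `[0,1)` matter). -/
def engelMap (x : ℝ) : ℝ :=
  if x = 0 then 0 else x * (⌈1 / x⌉₊ : ℝ) - 1

/-- The Engel series expansion of `x` is infinite: no iterate `T^k x` vanishes. -/
def HasInfiniteEngelExpansion (x : ℝ) : Prop :=
  ∀ k : ℕ, engelMap^[k] x ≠ 0

/-- The `n`-th digit of the Engel series expansion of `x`, for `n ≥ 1`: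
`d_n(x) = ⌈1 / T^(n-1) x⌉`, so that `d_1(x) = ⌈1/x⌉` and `d_(n+1)(x) = d_1(T^n x)`.
(The index `n = 0` is not used; a digit is meaningful only where `T^(n-1) x ≠ 0`.) -/
def engelDigit (x : ℝ) (n : ℕ) : ℕ :=
  ⌈1 / engelMap^[n - 1] x⌉₊

/-- The set of `x ∈ (0,1)`, with infinitely many Engel digits, for which
`liminf_{n → ∞} log d_n(x) / φ(n) = 1`. The lower limit is taken in the extended real line, so it
is the true one also where the quotients are unbounded. -/
def engelGrowthSet (φ : ℕ → ℝ) : Set ℝ :=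
  {x : ℝ | x ∈ Ioo (0 : ℝ) 1 ∧ HasInfiniteEngelExpansion x ∧
    liminf (fun n : ℕ => ((Real.log (engelDigit x n : ℝ) / φ n : ℝ) : EReal)) atTop = 1}

end

/-! Both bounds rest on `x = 1/d₁ + 1/(d₁d₂) + ⋯ + Tⁿx/(d₁⋯dₙ)` with `Tⁿx` comparable to `1/dₙ₊₁`.

Upper bound: if `1 < B < A`, every point of the set satisfies `log dₙ₊₁ ≥ K Bⁿ` for some `n`,
whatever `K` is. Stopping at the first such `n` bounds the earlier digits by `exp (K Bʲ)` and puts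
the point in an interval of length `2 / (d₁⋯dₙ exp (K Bⁿ))`. The `s`-th powers of these lengths
factor over the digits, and their sum stays bounded as `K → ∞` once `s B > 1`
(`sum_coverLength_rpow_le`). Hence the dimension is at most `1/B`.

Lower bound: if `A < B < 1/s`, replace `φ` by a majorant `L` whose growth ratio is at most `B` and
which still touches `φ` infinitely often (`exists_regularized_majorant`), so that the lower limit
remains 1. Letting the `n`-th digit range freely over a block of about `exp (L n)` integers gives a
Cantor set parametrized by `[0,1)` through a mixed radix expansion. The ratio bound makes `L n` at
most about `B - 1` times the sum of the earlier terms, so the inverse parametrization is `s`-Hölder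
and the dimension is at least `s`. -/

/-! ### The Engel map and the expansion with remainder. -/

theorem two_le_ceil_one_div {x : ℝ} (hx : x ∈ Ioo (0 : ℝ) 1) : 2 ≤ ⌈1 / x⌉₊ := by
  have h : 1 < 1 / x := by rw [lt_div_iff₀ hx.1]; linarith [hx.2]
  exact Nat.lt_ceil.2 (by simpa using h)

theorem engelMap_of_ne_zero {x : ℝ} (hx : x ≠ 0) : engelMap x = x * (⌈1 / x⌉₊ : ℝ) - 1 :=
  if_neg hx

theorem engelMap_nonneg {x : ℝ} (hx : 0 < x) : 0 ≤ engelMap x := by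
  rw [engelMap_of_ne_zero hx.ne']
  have h := Nat.le_ceil (1 / x)
  rw [div_le_iff₀ hx] at h
  linarith

theorem engelMap_lt_self {x : ℝ} (hx : 0 < x) : engelMap x < x := by
  rw [engelMap_of_ne_zero hx.ne']
  have h := Nat.ceil_lt_add_one (a := 1 / x) (by positivity)
  have h2 : x * (⌈1 / x⌉₊ : ℝ) < x * (1 / x + 1) := mul_lt_mul_of_pos_left h hx
  have h3 : x * (1 / x + 1) = 1 + x := by field_simp
  linarith

theorem iterate_engelMap_mem {x : ℝ} (hx : x ∈ Ioo (0 : ℝ) 1)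
    (hinf : HasInfiniteEngelExpansion x) (n : ℕ) : engelMap^[n] x ∈ Ioo (0 : ℝ) 1 := by
  induction n with
  | zero => simpa using hx
  | succ n ih =>
    have hne := hinf (n + 1)
    rw [Function.iterate_succ_apply'] at hne ⊢
    exact ⟨lt_of_le_of_ne (engelMap_nonneg ih.1) hne.symm, (engelMap_lt_self ih.1).trans ih.2⟩

theorem engelDigit_succ (x : ℝ) (n : ℕ) : engelDigit x (n + 1) = ⌈1 / engelMap^[n] x⌉₊ := rfl

theorem two_le_engelDigit {x : ℝ} (hx : x ∈ Ioo (0 : ℝ) 1)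
    (hinf : HasInfiniteEngelExpansion x) (n : ℕ) : 2 ≤ engelDigit x (n + 1) :=
  two_le_ceil_one_div (iterate_engelMap_mem hx hinf n)

/-- The finite Engel sum `1 / d 0 + 1 / (d 0 * d 1) + ⋯` with `n` terms. -/
noncomputable def engelSum (d : ℕ → ℕ) (n : ℕ) : ℝ :=
  ∑ i ∈ Finset.range n, 1 / ∏ j ∈ Finset.range (i + 1), (d j : ℝ)

/-- Iterates `y = (1 + T y) / d₁(y)`. -/
theorem eq_engelSum_add {x : ℝ} (hx : x ∈ Ioo (0 : ℝ) 1)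
    (hinf : HasInfiniteEngelExpansion x) (n : ℕ) :
    x = engelSum (fun j => engelDigit x (j + 1)) n +
      engelMap^[n] x / ∏ j ∈ Finset.range n, (engelDigit x (j + 1) : ℝ) := by
  induction n with
  | zero => simp [engelSum]
  | succ n ih =>
    have hpos : ∀ m, 0 < ∏ j ∈ Finset.range m, (engelDigit x (j + 1) : ℝ) := fun m =>
      Finset.prod_pos fun j _ => by
        have := two_le_engelDigit hx hinf j
        positivity
    have h0 := (iterate_engelMap_mem hx hinf n).1
    have hd : (0 : ℝ) < engelDigit x (n + 1) := by
      have := two_le_engelDigit hx hinf n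
      positivity
    have hstep : engelMap^[n + 1] x = engelMap^[n] x * engelDigit x (n + 1) - 1 := by
      rw [Function.iterate_succ_apply', engelMap_of_ne_zero h0.ne', engelDigit_succ]
    conv_lhs => rw [ih]
    rw [engelSum, engelSum, Finset.sum_range_succ, hstep, Finset.prod_range_succ]
    have := hpos n
    field_simp
    ring

theorem engelSum_congr {d d' : ℕ → ℕ} {n : ℕ} (h : ∀ j < n, d j = d' j) :
    engelSum d n = engelSum d' n := by
  refine Finset.sum_congr rfl fun i hi => ?_
  rw [Finset.prod_congr rfl fun j hj => ?_]
  rw [h j]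
  have := Finset.mem_range.1 hi
  have := Finset.mem_range.1 hj
  omega

/-- The iterates of the Engel map are controlled by the digits. -/
theorem iterate_engelMap_le {x : ℝ} (hx : x ∈ Ioo (0 : ℝ) 1)
    (hinf : HasInfiniteEngelExpansion x) (n : ℕ) :
    engelMap^[n] x ≤ 2 / engelDigit x (n + 1) := by
  have h0 := iterate_engelMap_mem hx hinf n
  have h := Nat.ceil_lt_add_one (a := 1 / engelMap^[n] x) (by have := h0.1; positivity)
  have h1 : 1 < 1 / engelMap^[n] x := by rw [lt_div_iff₀ h0.1]; linarith [h0.2]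
  have hd : (0 : ℝ) < engelDigit x (n + 1) := by
    have := two_le_engelDigit hx hinf n
    positivity
  rw [le_div_iff₀ hd, engelDigit_succ]
  have h2 : engelMap^[n] x * (⌈1 / engelMap^[n] x⌉₊ : ℝ) ≤
      engelMap^[n] x * (2 * (1 / engelMap^[n] x)) :=
    mul_le_mul_of_nonneg_left (by linarith) h0.1.le
  have h3 : engelMap^[n] x * (2 * (1 / engelMap^[n] x)) = 2 := by
    have := h0.1.ne'
    field_simp
  linarith

/-! ### Upper bound: covering by stopping at the first large digit. -/

/-- The points whose Engel digits grow faster than every `exp (K * B ^ n)` infinitely often. -/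
def fastEngelSet (B : ℝ) : Set ℝ :=
  {x | x ∈ Ioo (0 : ℝ) 1 ∧ HasInfiniteEngelExpansion x ∧
    ∀ K : ℝ, ∃ n : ℕ, K * B ^ n ≤ Real.log (engelDigit x (n + 1))}

/-- Write `d ^ (-s) = d ^ (-p) * d ^ (p - s)` and bound the last factor by its value at `D`. The
constant is `ζ(p)`, independent of `s` and `D`. -/
theorem exists_sum_rpow_neg_le {p : ℝ} (hp : 1 < p) : ∃ C : ℝ, 0 < C ∧
    ∀ s D : ℝ, s ≤ p → 0 < D →
      ∑ d ∈ Finset.Icc 1 ⌊D⌋₊, (d : ℝ) ^ (-s) ≤ C * D ^ (p - s) := by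
  have hsum : Summable fun d : ℕ => (d : ℝ) ^ (-p) := Real.summable_nat_rpow.2 (by linarith)
  refine ⟨∑' d : ℕ, (d : ℝ) ^ (-p), hsum.tsum_pos (fun d => by positivity) 1 (by simp), ?_⟩
  intro s D hs hD
  calc ∑ d ∈ Finset.Icc 1 ⌊D⌋₊, (d : ℝ) ^ (-s)
      ≤ ∑ d ∈ Finset.Icc 1 ⌊D⌋₊, (d : ℝ) ^ (-p) * D ^ (p - s) := by
        refine Finset.sum_le_sum fun d hd => ?_
        rw [Finset.mem_Icc] at hd
        have hd0 : (0 : ℝ) < d := by exact_mod_cast hd.1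
        have hdD : (d : ℝ) ≤ D := (Nat.le_floor_iff hD.le).1 hd.2
        rw [show -s = -p + (p - s) by ring, Real.rpow_add hd0]
        gcongr
    _ = (∑ d ∈ Finset.Icc 1 ⌊D⌋₊, (d : ℝ) ^ (-p)) * D ^ (p - s) := by rw [Finset.sum_mul]
    _ ≤ _ := by
        gcongr
        exact hsum.sum_le_tsum _ fun d _ => by positivity

/-- The admissible prefixes of length `n`, with `j`-th entry between `1` and `exp (K * B ^ j)`. -/
noncomputable def engelPrefixes (B K : ℝ) (n : ℕ) : Finset (Fin n → ℕ) :=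
  Fintype.piFinset fun j : Fin n => Finset.Icc 1 ⌊Real.exp (K * B ^ (j : ℕ))⌋₊

/-- The length of the interval covering the points with a given prefix `d` and a large next
digit. -/
noncomputable def coverLength (B K : ℝ) (n : ℕ) (d : Fin n → ℕ) : ℝ :=
  2 / ((∏ j, (d j : ℝ)) * Real.exp (K * B ^ n))

/-- Extension of a finite prefix by zero. -/
def extendPrefix {n : ℕ} (d : Fin n → ℕ) (j : ℕ) : ℕ :=
  if h : j < n then d ⟨j, h⟩ else 0

theorem coverLength_nonneg (B K : ℝ) (n : ℕ) (d : Fin n → ℕ) : 0 ≤ coverLength B K n d := by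
  unfold coverLength
  have : 0 ≤ ∏ j, (d j : ℝ) := Finset.prod_nonneg fun j _ => by positivity
  positivity

theorem one_le_prod_of_mem_engelPrefixes {B K : ℝ} {n : ℕ} {d : Fin n → ℕ}
    (hd : d ∈ engelPrefixes B K n) : 1 ≤ ∏ j, (d j : ℝ) := by
  have h : 1 ≤ ∏ j, d j := Finset.one_le_prod' fun j _ =>
    (Finset.mem_Icc.1 (Fintype.mem_piFinset.1 hd j)).1
  exact_mod_cast h

theorem coverLength_le {B K : ℝ} (hB : 1 ≤ B) (hK : 0 ≤ K) {n : ℕ} {d : Fin n → ℕ}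
    (hd : d ∈ engelPrefixes B K n) : coverLength B K n d ≤ 2 * Real.exp (-K) := by
  unfold coverLength
  have h1 := one_le_prod_of_mem_engelPrefixes hd
  rw [div_le_iff₀ (by positivity)]
  have h2 : Real.exp K ≤ Real.exp (K * B ^ n) :=
    Real.exp_le_exp.2 (le_mul_of_one_le_right hK (one_le_pow₀ hB))
  have h3 : Real.exp K ≤ (∏ j, (d j : ℝ)) * Real.exp (K * B ^ n) := by
    nlinarith [Real.exp_pos (K * B ^ n)]
  calc (2 : ℝ) = 2 * Real.exp (-K) * Real.exp K := by
        rw [mul_assoc, ← Real.exp_add]; simp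
    _ ≤ _ := by gcongr

/-- The sum over prefixes is a product of one-digit sums, at most `Cⁿ exp ((p - s) K ∑ Bʲ)`. The
geometric sum is below `Bⁿ / (B - 1)`, and this competes with the gain `exp (-s K Bⁿ)` from the
large digit. -/
theorem sum_coverLength_rpow_le {B s p C K : ℝ} (hB : 1 < B) (hsp : s ≤ p)
    (hC : 0 < C) (hK : 0 ≤ K)
    (h : ∀ D : ℝ, 0 < D → ∑ d ∈ Finset.Icc 1 ⌊D⌋₊, (d : ℝ) ^ (-s) ≤ C * D ^ (p - s)) (n : ℕ) :
    ∑ d ∈ engelPrefixes B K n, coverLength B K n d ^ s ≤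
      2 ^ s * (C ^ n * Real.exp (-((s - (p - s) / (B - 1)) * K * B ^ n))) := by
  have hterm : ∀ d ∈ engelPrefixes B K n, coverLength B K n d ^ s =
      2 ^ s * Real.exp (-(s * K * B ^ n)) * ∏ j, (d j : ℝ) ^ (-s) := by
    intro d _
    have hp : 0 ≤ ∏ j, (d j : ℝ) := Finset.prod_nonneg fun j _ => by positivity
    rw [coverLength, Real.div_rpow (by norm_num) (by positivity),
      Real.mul_rpow hp (Real.exp_pos _).le, ← Real.finsetProd_rpow _ _ (fun j _ => by positivity),
      ← Real.exp_mul]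
    simp_rw [Real.rpow_neg (Nat.cast_nonneg _), Finset.prod_inv_distrib]
    rw [Real.exp_neg, div_eq_mul_inv, mul_inv]
    ring_nf
  rw [Finset.sum_congr rfl hterm, ← Finset.mul_sum, engelPrefixes,
    ← Finset.prod_univ_sum (fun j : Fin n => Finset.Icc 1 ⌊Real.exp (K * B ^ (j : ℕ))⌋₊)
      (fun _ d => (d : ℝ) ^ (-s))]
  have hprod : ∏ j : Fin n, ∑ d ∈ Finset.Icc 1 ⌊Real.exp (K * B ^ (j : ℕ))⌋₊, (d : ℝ) ^ (-s) ≤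
      C ^ n * Real.exp ((p - s) / (B - 1) * K * B ^ n) := by
    calc _ ≤ ∏ j : Fin n, (C * Real.exp (K * B ^ (j : ℕ)) ^ (p - s)) :=
          Finset.prod_le_prod (fun j _ => Finset.sum_nonneg fun d _ => by positivity)
            (fun j _ => h _ (Real.exp_pos _))
      _ = C ^ n * Real.exp ((p - s) * K * ∑ j ∈ Finset.range n, B ^ j) := by
          rw [Finset.prod_mul_distrib, Finset.mul_sum, Finset.sum_range, Real.exp_sum]
          simp only [Finset.prod_const, Finset.card_univ, Fintype.card_fin, ← Real.exp_mul]
          ring_nf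
      _ ≤ _ := by
          rw [geom_sum_eq hB.ne']
          refine mul_le_mul_of_nonneg_left (Real.exp_le_exp.2 ?_) (by positivity)
          have hB1 : 0 < B - 1 := by linarith
          have hle : (B ^ n - 1) / (B - 1) ≤ B ^ n / (B - 1) := by gcongr; linarith
          calc (p - s) * K * ((B ^ n - 1) / (B - 1)) ≤ (p - s) * K * (B ^ n / (B - 1)) :=
                mul_le_mul_of_nonneg_left hle (mul_nonneg (by linarith) hK)
            _ = (p - s) / (B - 1) * K * B ^ n := by ring
  calc _ ≤ 2 ^ s * Real.exp (-(s * K * B ^ n)) *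
        (C ^ n * Real.exp ((p - s) / (B - 1) * K * B ^ n)) := by gcongr
    _ = 2 ^ s * (C ^ n * (Real.exp (-(s * K * B ^ n)) *
          Real.exp ((p - s) / (B - 1) * K * B ^ n))) := by ring
    _ = _ := by rw [← Real.exp_add]; ring_nf

/-- The index `n` is the first one with `K * B ^ n ≤ log dₙ₊₁`: minimality makes the prefix
admissible, and the large next digit makes the remainder small. -/
theorem fastEngelSet_subset_iUnion (B K : ℝ) :
    fastEngelSet B ⊆ ⋃ i : Σ n, engelPrefixes B K n,
      Icc (engelSum (extendPrefix i.2.1) i.1)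
        (engelSum (extendPrefix i.2.1) i.1 + coverLength B K i.1 i.2.1) := by
  classical
  rintro x ⟨hx, hinf, hfast⟩
  have hn := Nat.find_spec (hfast K)
  have hlt : ∀ j < Nat.find (hfast K), Real.log (engelDigit x (j + 1)) < K * B ^ j :=
    fun j hj => not_le.1 (Nat.find_min (hfast K) hj)
  generalize Nat.find (hfast K) = n at hn hlt
  have hpos : ∀ j, (0 : ℝ) < engelDigit x (j + 1) := fun j => by
    have := two_le_engelDigit hx hinf j
    positivity
  have hmem : (fun j : Fin n => engelDigit x (j + 1)) ∈ engelPrefixes B K n := by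
    refine Fintype.mem_piFinset.2 fun j => Finset.mem_Icc.2 ⟨?_, Nat.le_floor ?_⟩
    · exact (two_le_engelDigit hx hinf j).trans' one_le_two
    · exact ((Real.log_lt_iff_lt_exp (hpos j)).1 (hlt j j.2)).le
  refine mem_iUnion.2 ⟨⟨n, _, hmem⟩, ?_⟩
  have hq : engelSum (extendPrefix fun j : Fin n => engelDigit x (j + 1)) n =
      engelSum (fun j => engelDigit x (j + 1)) n :=
    engelSum_congr fun j hj => by simp [extendPrefix, hj]
  have hexp := eq_engelSum_add hx hinf n
  have hprod : 0 < ∏ j ∈ Finset.range n, (engelDigit x (j + 1) : ℝ) :=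
    Finset.prod_pos fun j _ => hpos j
  simp only [hq]
  have h0 := (iterate_engelMap_mem hx hinf n).1
  constructor
  · rw [hexp, ← hexp]
    have : 0 < engelMap^[n] x / ∏ j ∈ Finset.range n, (engelDigit x (j + 1) : ℝ) := by positivity
    linarith
  · have h1 : engelMap^[n] x ≤ 2 / Real.exp (K * B ^ n) := by
      refine (iterate_engelMap_le hx hinf n).trans ?_
      gcongr
      exact (Real.le_log_iff_exp_le (hpos n)).1 hn
    have h2 : engelMap^[n] x / ∏ j ∈ Finset.range n, (engelDigit x (j + 1) : ℝ) ≤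
        coverLength B K n fun j => engelDigit x (j + 1) := by
      rw [coverLength, ← Finset.prod_range fun j => (engelDigit x (j + 1) : ℝ), mul_comm,
        ← div_div]
      gcongr
    linarith

open MeasureTheory in
theorem dimH_fastEngelSet_le_of_lt {B : ℝ} (hB : 1 < B) {s : NNReal} (hsB : 1 < s * B)
    (hs1 : s ≤ 1) : dimH (fastEngelSet B) ≤ s := by
  apply dimH_le_of_hausdorffMeasure_ne_top
  -- The midpoint of 1 and `s * B`: `p > 1` gives convergence, and `p < s * B` is exactly what makes
  -- `η` positive.
  set p : ℝ := (1 + s * B) / 2 with hp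
  have hp1 : 1 < p := by linarith
  have hs1' : (s : ℝ) ≤ 1 := by exact_mod_cast hs1
  have hsp : (s : ℝ) ≤ p := by linarith
  set η : ℝ := s - (p - s) / (B - 1) with hη
  have hη0 : 0 < η := by
    rw [hη, sub_pos, div_lt_iff₀ (by linarith)]
    linarith
  obtain ⟨C, hC, hCsum⟩ := exists_sum_rpow_neg_le hp1
  have hρ : Tendsto (fun K : ℕ => C * Real.exp (-(η * (B - 1) * K))) atTop (𝓝 0) := by
    have : Tendsto (fun K : ℕ => η * (B - 1) * (K : ℝ)) atTop atTop :=
      tendsto_natCast_atTop_atTop.const_mul_atTop (mul_pos hη0 (by linarith))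
    simpa using (Real.tendsto_exp_neg_atTop_nhds_zero.comp this).const_mul C
  have hev : ∀ᶠ K : ℕ in atTop, C * Real.exp (-(η * (B - 1) * K)) ≤ 1 / 2 :=
    hρ.eventually_le_const (by norm_num)
  have hr : Tendsto (fun K : ℕ => ENNReal.ofReal (2 * Real.exp (-(K : ℝ)))) atTop (𝓝 0) := by
    have := (Real.tendsto_exp_neg_atTop_nhds_zero.comp
      (tendsto_natCast_atTop_atTop (R := ℝ))).const_mul 2
    simpa using ENNReal.tendsto_ofReal this
  have key := Measure.hausdorffMeasure_le_liminf_tsum (ι := fun K : ℕ => Σ n, engelPrefixes B K n)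
    (s : ℝ) (fastEngelSet B) (fun K : ℕ => ENNReal.ofReal (2 * Real.exp (-(K : ℝ)))) hr
    (fun K i => Icc (engelSum (extendPrefix i.2.1) i.1)
        (engelSum (extendPrefix i.2.1) i.1 + coverLength B K i.1 i.2.1))
    (Eventually.of_forall fun K i => by
      rw [Real.ediam_Icc, add_sub_cancel_left]
      exact ENNReal.ofReal_le_ofReal (coverLength_le hB.le (Nat.cast_nonneg K) i.2.2))
    (Eventually.of_forall fun K => fastEngelSet_subset_iUnion B K)
  refine ne_top_of_le_ne_top (b := ENNReal.ofReal (2 ^ (s : ℝ) * 2)) ENNReal.ofReal_ne_top (key.trans ?_)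
  refine liminf_le_of_frequently_le' (Eventually.frequently ?_)
  filter_upwards [hev] with K hK
  have hgeo : Summable fun n : ℕ => (2 : ℝ) ^ (s : ℝ) * (1 / 2) ^ n := summable_geometric_two.mul_left _
  calc ∑' i : Σ n, engelPrefixes B K n, Metric.ediam (Icc (engelSum (extendPrefix i.2.1) i.1)
        (engelSum (extendPrefix i.2.1) i.1 + coverLength B K i.1 i.2.1)) ^ (s : ℝ)
      = ∑' n, ENNReal.ofReal (∑ d ∈ engelPrefixes B K n, coverLength B K n d ^ (s : ℝ)) := by
        rw [ENNReal.tsum_sigma']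
        refine tsum_congr fun n => ?_
        rw [ENNReal.ofReal_sum_of_nonneg fun d _ =>
          Real.rpow_nonneg (coverLength_nonneg B K n d) _, tsum_fintype,
          ← Finset.sum_coe_sort (engelPrefixes B K n)]
        refine Finset.sum_congr rfl fun d _ => ?_
        dsimp only
        rw [Real.ediam_Icc, add_sub_cancel_left,
          ENNReal.ofReal_rpow_of_nonneg (coverLength_nonneg B K n d.1) s.coe_nonneg]
    _ ≤ ∑' n : ℕ, ENNReal.ofReal ((2 : ℝ) ^ (s : ℝ) * (1 / 2) ^ n) := by
        refine ENNReal.tsum_le_tsum fun n => ENNReal.ofReal_le_ofReal ?_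
        refine (sum_coverLength_rpow_le hB hsp hC (Nat.cast_nonneg K)
          (fun D hD => hCsum s D hsp hD) n).trans ?_
        gcongr
        -- Bernoulli's inequality turns the double exponential into a geometric series, whose ratio
        -- is at most `1 / 2` for large `K`.
        have hbern : 1 + n * (B - 1) ≤ B ^ n := by
          have := one_add_mul_le_pow (a := B - 1) (by linarith) n
          simpa using this
        calc C ^ n * Real.exp (-(η * K * B ^ n))
            ≤ C ^ n * Real.exp (n * -(η * (B - 1) * K)) := by
              gcongr
              have hηK : 0 ≤ η * K := by positivity
              nlinarith
          _ = (C * Real.exp (-(η * (B - 1) * K))) ^ n := by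
              rw [mul_pow, ← Real.exp_nat_mul]
          _ ≤ (1 / 2) ^ n := by gcongr
    _ = ENNReal.ofReal ((2 : ℝ) ^ (s : ℝ) * 2) := by
        rw [← ENNReal.ofReal_tsum_of_nonneg (fun n => by positivity) hgeo, tsum_mul_left,
          tsum_geometric_two]

theorem dimH_fastEngelSet_le {B : ℝ} (hB : 1 < B) :
    dimH (fastEngelSet B) ≤ ENNReal.ofReal (1 / B) := by
  have hB0 : 0 < B := by linarith
  refine le_of_forall_gt_imp_ge_of_dense fun c hc => ?_
  have h1 : ENNReal.ofReal (1 / B) < 1 := by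
    rw [ENNReal.ofReal_lt_one, div_lt_one hB0]
    exact hB
  obtain ⟨s, hs, hsc⟩ := ENNReal.lt_iff_exists_nnreal_btwn.1 (lt_min hc h1)
  rw [lt_min_iff] at hsc
  refine (dimH_fastEngelSet_le_of_lt hB ?_ ?_).trans hsc.1.le
  · have : 1 / B < s := by
      rw [← ENNReal.ofReal_coe_nnreal, ENNReal.ofReal_lt_ofReal_iff_of_nonneg (by positivity)] at hs
      exact hs
    rwa [div_lt_iff₀ hB0] at this
  · exact_mod_cast hsc.2.le

/-! ### Engel series with prescribed strictly increasing digits. -/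

/-- The Engel series with digits `d n, d (n + 1), …`. -/
noncomputable def engelTail (d : ℕ → ℕ) (n : ℕ) : ℝ :=
  ∑' i : ℕ, 1 / ∏ j ∈ Finset.range (i + 1), (d (n + j) : ℝ)

section engelTail

variable {d : ℕ → ℕ} (hd : StrictMono d) (h2 : ∀ n, 2 ≤ d n)
include hd h2

theorem engelTail_term_le (n i : ℕ) :
    1 / ∏ j ∈ Finset.range (i + 1), (d (n + j) : ℝ) ≤ (1 / (d n : ℝ)) * (1 / (d n : ℝ)) ^ i := by
  have h0 : (0 : ℝ) < d n := by have := h2 n; positivity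
  rw [← pow_succ', one_div_pow]
  have h : (d n : ℝ) ^ (i + 1) ≤ ∏ j ∈ Finset.range (i + 1), (d (n + j) : ℝ) := by
    have := Finset.prod_le_prod (s := Finset.range (i + 1)) (f := fun _ => (d n : ℝ))
      (g := fun j => (d (n + j) : ℝ)) (fun _ _ => h0.le)
      (fun j _ => by exact_mod_cast hd.monotone (Nat.le_add_right n j))
    simpa using this
  gcongr

omit hd in
theorem summable_engelTail_bound (n : ℕ) :
    Summable fun i : ℕ => (1 / (d n : ℝ)) * (1 / (d n : ℝ)) ^ i := by
  have h := h2 n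
  have h' : (2 : ℝ) ≤ d n := by exact_mod_cast h
  refine (summable_geometric_of_lt_one (by positivity) ?_).mul_left _
  rw [div_lt_one (by linarith)]
  linarith

theorem summable_engelTail (n : ℕ) :
    Summable fun i : ℕ => 1 / ∏ j ∈ Finset.range (i + 1), (d (n + j) : ℝ) :=
  Summable.of_nonneg_of_le
    (fun _ => one_div_nonneg.2 (Finset.prod_nonneg fun _ _ => Nat.cast_nonneg _))
    (engelTail_term_le hd h2 n) (summable_engelTail_bound h2 n)

theorem engelTail_pos (n : ℕ) : 0 < engelTail d n := by
  have hp : ∀ i, 0 < 1 / ∏ j ∈ Finset.range (i + 1), (d (n + j) : ℝ) := fun i =>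
    one_div_pos.2 (Finset.prod_pos fun j _ => by have := h2 (n + j); positivity)
  exact (summable_engelTail hd h2 n).tsum_pos (fun i => (hp i).le) 0 (hp 0)

theorem engelTail_le (n : ℕ) : engelTail d n ≤ 1 / ((d n : ℝ) - 1) := by
  have h' : (2 : ℝ) ≤ d n := by exact_mod_cast h2 n
  calc engelTail d n ≤ ∑' i : ℕ, (1 / (d n : ℝ)) * (1 / (d n : ℝ)) ^ i :=
        (summable_engelTail hd h2 n).tsum_le_tsum (engelTail_term_le hd h2 n)
          (summable_engelTail_bound h2 n)
    _ = _ := by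
        rw [tsum_mul_left, tsum_geometric_of_lt_one (by positivity)
          (by rw [div_lt_one (by linarith)]; linarith)]
        have h3 : (d n : ℝ) - 1 ≠ 0 := by linarith
        field_simp

theorem engelTail_eq (n : ℕ) : engelTail d n = (1 + engelTail d (n + 1)) / d n := by
  have h0 : (0 : ℝ) < d n := by have := h2 n; positivity
  rw [engelTail, (summable_engelTail hd h2 n).tsum_eq_zero_add, add_div, engelTail, ← tsum_div_const]
  congr 1
  · simp
  · refine tsum_congr fun i => ?_
    rw [Finset.prod_range_succ', div_div]
    simp only [add_zero]
    congr 2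
    refine Finset.prod_congr rfl fun j _ => ?_
    rw [add_assoc, add_comm 1 j]

/-- Strictness comes from `d n < d (n + 1)`. It is needed for the ceiling of `1 / engelTail d n` to
be `d n` and not `d n - 1`. -/
theorem engelTail_lt (n : ℕ) : engelTail d n < 1 / ((d n : ℝ) - 1) := by
  have h' : (2 : ℝ) ≤ d n := by exact_mod_cast h2 n
  have hlt : (d n : ℝ) < d (n + 1) := by exact_mod_cast hd (Nat.lt_succ_self n)
  have h1 : engelTail d (n + 1) < 1 / ((d n : ℝ) - 1) := by
    refine (engelTail_le hd h2 (n + 1)).trans_lt ?_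
    apply one_div_lt_one_div_of_lt <;> linarith
  rw [engelTail_eq hd h2, div_lt_iff₀ (by linarith)]
  have h3 : 1 / ((d n : ℝ) - 1) * d n = 1 + 1 / ((d n : ℝ) - 1) := by
    have : (d n : ℝ) - 1 ≠ 0 := by linarith
    field_simp
    ring
  linarith

theorem ceil_one_div_engelTail (n : ℕ) : ⌈1 / engelTail d n⌉₊ = d n := by
  have h' : (2 : ℝ) ≤ d n := by exact_mod_cast h2 n
  have h0 := engelTail_pos hd h2 n
  have h1 := engelTail_pos hd h2 (n + 1)
  rw [Nat.ceil_eq_iff (by have := h2 n; omega)]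
  constructor
  · rw [lt_div_iff₀ h0, Nat.cast_sub (by have := h2 n; omega), Nat.cast_one, mul_comm,
      ← lt_div_iff₀ (by linarith)]
    exact engelTail_lt hd h2 n
  · rw [engelTail_eq hd h2, div_le_iff₀ (by positivity), mul_div_cancel₀ _ (by linarith)]
    linarith

theorem iterate_engelMap_engelTail (n : ℕ) : engelMap^[n] (engelTail d 0) = engelTail d n := by
  induction n with
  | zero => rfl
  | succ n ih =>
    have h' : (2 : ℝ) ≤ d n := by exact_mod_cast h2 n
    rw [Function.iterate_succ_apply', ih, engelMap_of_ne_zero (engelTail_pos hd h2 n).ne',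
      ceil_one_div_engelTail hd h2, engelTail_eq hd h2, div_mul_cancel₀ _ (by linarith)]
    ring

theorem engelDigit_engelTail (n : ℕ) : engelDigit (engelTail d 0) (n + 1) = d n := by
  rw [engelDigit_succ, iterate_engelMap_engelTail hd h2, ceil_one_div_engelTail hd h2]

theorem hasInfiniteEngelExpansion_engelTail : HasInfiniteEngelExpansion (engelTail d 0) :=
  fun n => by
    rw [iterate_engelMap_engelTail hd h2]
    exact (engelTail_pos hd h2 n).ne'

theorem engelTail_mem_Ioo : engelTail d 0 ∈ Ioo (0 : ℝ) 1 := by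
  have h' : (2 : ℝ) ≤ d 0 := by exact_mod_cast h2 0
  refine ⟨engelTail_pos hd h2 0, (engelTail_lt hd h2 0).trans_le ?_⟩
  rw [div_le_one] <;> linarith

end engelTail

theorem engelTail_sub_eq {d d' : ℕ → ℕ} (hd : StrictMono d) (h2 : ∀ n, 2 ≤ d n)
    (hd' : StrictMono d') (h2' : ∀ n, 2 ≤ d' n) {n : ℕ} (h : ∀ j < n, d j = d' j) :
    engelTail d 0 - engelTail d' 0 =
      (engelTail d n - engelTail d' n) / ∏ j ∈ Finset.range n, (d j : ℝ) := by
  induction n with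
  | zero => simp
  | succ n ih =>
    rw [ih fun j hj => h j (by omega), engelTail_eq hd h2 n, engelTail_eq hd' h2' n,
      ← h n (by omega), Finset.prod_range_succ, ← sub_div, div_div, mul_comm]
    ring_nf

/-- Over the common denominator the numerator is at least `d' n - d n - (1 - δ)`, after dropping a
nonnegative term. As the digits differ by at least 1, this is at least `δ (d' n - d n)`. -/
theorem sub_engelTail_ge {d d' : ℕ → ℕ} (hd : StrictMono d) (h2 : ∀ n, 2 ≤ d n)
    (hd' : StrictMono d') (h2' : ∀ n, 2 ≤ d' n) {n : ℕ} {δ : ℝ}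
    (hgap : (d n : ℝ) * engelTail d' (n + 1) ≤ 1 - δ) (hlt : d n < d' n) (hδ : δ ≤ 1) :
    δ * (d' n - d n) / (d n * d' n) ≤ engelTail d n - engelTail d' n := by
  have h0 : (2 : ℝ) ≤ d n := by exact_mod_cast h2 n
  have h0' : (2 : ℝ) ≤ d' n := by exact_mod_cast h2' n
  have h1 := engelTail_pos hd h2 (n + 1)
  have hlt' : (d n : ℝ) + 1 ≤ d' n := by exact_mod_cast hlt
  rw [engelTail_eq hd h2 n, engelTail_eq hd' h2' n, div_sub_div _ _ (by linarith) (by linarith)]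
  have : 0 ≤ engelTail d (n + 1) * d' n := by positivity
  gcongr
  nlinarith

/-! ### The Cantor set and its mixed radix parametrization. -/

section mixedRadix

variable (M : ℕ → ℕ)

/-- The partial products of the mixed radix system with bases `M`. -/
def radixProd (n : ℕ) : ℕ := ∏ j ∈ Finset.range n, M j

/-- The digits of `t ∈ [0, 1)` in the mixed radix system with bases `M`. -/
noncomputable def radixDigit (t : ℝ) (n : ℕ) : ℕ := ⌊(radixProd M (n + 1) : ℝ) * t⌋₊ % M n

/-- Engel digits in consecutive blocks of lengths `M n`, chosen according to the mixed radix
digits of `t`. -/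
noncomputable def cantorDigit (t : ℝ) (n : ℕ) : ℕ := 2 * (n + 1) * M n + 1 + radixDigit M t n

/-- The point of the Cantor set parametrized by `t`. -/
noncomputable def cantorPoint (t : ℝ) : ℝ := engelTail (cantorDigit M t) 0

variable {M} (hM : Monotone M) (h2 : ∀ n, 2 ≤ M n)

include h2

theorem radixProd_pos (n : ℕ) : 0 < radixProd M n :=
  Finset.prod_pos fun j _ => by have := h2 j; omega

theorem two_pow_le_radixProd (n : ℕ) : 2 ^ n ≤ radixProd M n := by
  have := Finset.pow_card_le_prod (Finset.range n) M 2 fun j _ => h2 j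
  simpa [radixProd] using this

theorem floor_radixProd_succ (t : ℝ) (n : ℕ) :
    ⌊(radixProd M (n + 1) : ℝ) * t⌋₊ = M n * ⌊(radixProd M n : ℝ) * t⌋₊ + radixDigit M t n := by
  have h : ⌊(radixProd M n : ℝ) * t⌋₊ = ⌊(radixProd M (n + 1) : ℝ) * t⌋₊ / M n := by
    rw [← Nat.floor_div_natCast]
    congr 1
    have : (M n : ℝ) ≠ 0 := by have := h2 n; positivity
    rw [radixProd, radixProd, Finset.prod_range_succ]
    push_cast
    field_simp
  rw [h, radixDigit, Nat.div_add_mod]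

theorem floor_radixProd_congr {t t' : ℝ} (ht : t ∈ Ico (0 : ℝ) 1) (ht' : t' ∈ Ico (0 : ℝ) 1)
    {n : ℕ} (h : ∀ j < n, radixDigit M t j = radixDigit M t' j) :
    ⌊(radixProd M n : ℝ) * t⌋₊ = ⌊(radixProd M n : ℝ) * t'⌋₊ := by
  induction n with
  | zero =>
    simp [radixProd, Nat.floor_eq_zero.2 ht.2, Nat.floor_eq_zero.2 ht'.2]
  | succ n ih =>
    rw [floor_radixProd_succ h2, floor_radixProd_succ h2, ih fun j hj => h j (by omega),
      h n (by omega)]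

/-- Equal digits would force `|t - t'| ≤ 1 / radixProd M n ≤ 2⁻ⁿ` for every `n`. -/
theorem exists_radixDigit_ne {t t' : ℝ} (ht : t ∈ Ico (0 : ℝ) 1) (ht' : t' ∈ Ico (0 : ℝ) 1)
    (hlt : t < t') : ∃ n, radixDigit M t n ≠ radixDigit M t' n := by
  by_contra! h
  obtain ⟨n, hn⟩ := pow_unbounded_of_one_lt (1 / (t' - t)) (one_lt_two (α := ℝ))
  have hP : (2 : ℝ) ^ n ≤ radixProd M n := by exact_mod_cast two_pow_le_radixProd h2 n
  have heq := floor_radixProd_congr h2 ht ht' (n := n) fun j _ => h j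
  have h1 := Nat.floor_le (a := (radixProd M n : ℝ) * t) (mul_nonneg (by positivity) ht.1)
  have h3 := Nat.lt_floor_add_one ((radixProd M n : ℝ) * t')
  rw [← heq] at h3
  rw [div_lt_iff₀ (by linarith)] at hn
  nlinarith

theorem radixDigit_lt (t : ℝ) (n : ℕ) : radixDigit M t n < M n :=
  Nat.mod_lt _ (by have := h2 n; omega)

/-- The first differing digit controls the distance of two numbers. -/
theorem exists_first_radixDigit_lt {t t' : ℝ} (ht : t ∈ Ico (0 : ℝ) 1)
    (ht' : t' ∈ Ico (0 : ℝ) 1) (hlt : t < t') :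
    ∃ n, (∀ j < n, radixDigit M t j = radixDigit M t' j) ∧ radixDigit M t n < radixDigit M t' n ∧
      t' - t ≤ 2 * ((radixDigit M t' n : ℝ) - radixDigit M t n) / radixProd M (n + 1) := by
  classical
  have hex := exists_radixDigit_ne h2 ht ht' hlt
  have hne := Nat.find_spec hex
  have heq : ∀ j < Nat.find hex, radixDigit M t j = radixDigit M t' j :=
    fun j hj => not_not.1 (Nat.find_min hex hj)
  generalize Nat.find hex = n at hne heq
  have hfl := floor_radixProd_congr h2 ht ht' heq
  have hs := floor_radixProd_succ h2 t n
  have hs' := floor_radixProd_succ h2 t' n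
  have hP : (0 : ℝ) < radixProd M (n + 1) := by exact_mod_cast radixProd_pos h2 (n + 1)
  have hle : ⌊(radixProd M (n + 1) : ℝ) * t⌋₊ ≤ ⌊(radixProd M (n + 1) : ℝ) * t'⌋₊ :=
    Nat.floor_le_floor (by gcongr)
  rw [hs, hs', hfl] at hle
  have hlt' : radixDigit M t n < radixDigit M t' n := by omega
  refine ⟨n, heq, hlt', ?_⟩
  have h1 := Nat.floor_le (a := (radixProd M (n + 1) : ℝ) * t) (mul_nonneg hP.le ht.1)
  have h3 := Nat.lt_floor_add_one ((radixProd M (n + 1) : ℝ) * t')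
  rw [hs, hfl] at h1
  rw [hs'] at h3
  push_cast at h1 h3
  -- With `k ≥ 1` the digit difference, the floors give `t' - t ≤ (k + 1) / radixProd M (n + 1)`,
  -- and `k + 1 ≤ 2k`.
  have h4 : (radixDigit M t n : ℝ) + 1 ≤ radixDigit M t' n := by exact_mod_cast hlt'
  rw [le_div_iff₀ hP]
  nlinarith

theorem cantorDigit_le (t : ℝ) (n : ℕ) : cantorDigit M t n ≤ (2 * n + 3) * M n := by
  have := radixDigit_lt h2 t n
  unfold cantorDigit
  nlinarith

theorem two_le_cantorDigit (t : ℝ) (n : ℕ) : 2 ≤ cantorDigit M t n := by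
  have := h2 n
  unfold cantorDigit
  nlinarith [Nat.zero_le (n * M n)]

include hM

/-- The factor `2 * (n + 1)` in the digits moves consecutive blocks apart even where `M` is
constant. The relative gap `1 / (2n + 4)` serves both monotonicity of digits and separation of
points. -/
theorem cantorDigit_mul_lt (t t' : ℝ) (n : ℕ) :
    cantorDigit M t n * (2 * n + 4) ≤ (2 * n + 3) * (cantorDigit M t' (n + 1) - 1) := by
  have h := cantorDigit_le h2 t n
  have hm := hM (Nat.le_succ n)
  have h' : (2 * n + 4) * M (n + 1) ≤ cantorDigit M t' (n + 1) - 1 := by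
    unfold cantorDigit
    have : 2 * (n + 1 + 1) * M (n + 1) = (2 * n + 4) * M (n + 1) := by ring
    omega
  calc cantorDigit M t n * (2 * n + 4) ≤ (2 * n + 3) * M n * (2 * n + 4) := by gcongr
    _ = (2 * n + 3) * ((2 * n + 4) * M n) := by ring
    _ ≤ (2 * n + 3) * ((2 * n + 4) * M (n + 1)) := by gcongr
    _ ≤ _ := by gcongr

theorem strictMono_cantorDigit (t : ℝ) : StrictMono (cantorDigit M t) := by
  refine strictMono_nat_of_lt_succ fun n => ?_
  have h := cantorDigit_mul_lt hM h2 t t n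
  have h1 := two_le_cantorDigit h2 t (n + 1)
  by_contra! hle
  have : (2 * n + 3) * (cantorDigit M t (n + 1) - 1) ≤ (2 * n + 3) * cantorDigit M t n := by
    gcongr
    omega
  have := two_le_cantorDigit h2 t n
  nlinarith

/-- The polynomial loss in the comparison of the two parametrizations. -/
noncomputable def separationLoss (n : ℕ) : ℝ :=
  (2 * n + 4) * (2 * n + 3) ^ 2 * ∏ j ∈ Finset.range n, (2 * (j : ℝ) + 3)

omit hM h2 in
theorem separationLoss_pos (n : ℕ) : 0 < separationLoss n := by
  unfold separationLoss
  have : 0 < ∏ j ∈ Finset.range n, (2 * (j : ℝ) + 3) := Finset.prod_pos fun j _ => by positivity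
  positivity

/-- Here `n` is the first differing radix digit and `u` is the digit difference divided by `M n`.
The orientation reverses because larger digits give smaller points. -/
theorem exists_cantorPoint_separation {t t' : ℝ} (ht : t ∈ Ico (0 : ℝ) 1)
    (ht' : t' ∈ Ico (0 : ℝ) 1) (hlt : t < t') :
    ∃ (n : ℕ) (u : ℝ), 0 < u ∧ u ≤ 1 ∧ t' - t ≤ 2 * (u / radixProd M n) ∧
      u / (radixProd M n * separationLoss n * M n) ≤ cantorPoint M t - cantorPoint M t' := by
  obtain ⟨n, heq, hdlt, hdist⟩ := exists_first_radixDigit_lt h2 ht ht' hlt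
  have hMpos : (0 : ℝ) < M n := by have := h2 n; positivity
  have hPpos : (0 : ℝ) < radixProd M n := by exact_mod_cast radixProd_pos h2 n
  have hk : (0 : ℝ) < (radixDigit M t' n : ℝ) - radixDigit M t n := by
    rw [sub_pos]; exact_mod_cast hdlt
  refine ⟨n, ((radixDigit M t' n : ℝ) - radixDigit M t n) / M n, by positivity, ?_, ?_, ?_⟩
  · rw [div_le_one hMpos]
    have : (radixDigit M t' n : ℝ) ≤ M n := by exact_mod_cast (radixDigit_lt h2 t' n).le
    have : (0 : ℝ) ≤ radixDigit M t n := by positivity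
    linarith
  · refine hdist.trans (le_of_eq ?_)
    have hP : (radixProd M (n + 1) : ℝ) = radixProd M n * M n := by
      rw [radixProd, radixProd, Finset.prod_range_succ]; push_cast; rfl
    rw [hP]
    field_simp
  · have hs := strictMono_cantorDigit hM h2 t
    have hs' := strictMono_cantorDigit hM h2 t'
    have hpre : ∀ j < n, cantorDigit M t j = cantorDigit M t' j := fun j hj => by
      rw [cantorDigit, cantorDigit, heq j hj]
    rw [cantorPoint, cantorPoint,
      engelTail_sub_eq hs (two_le_cantorDigit h2 t) hs' (two_le_cantorDigit h2 t') hpre]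
    have hdiff : (cantorDigit M t' n : ℝ) - cantorDigit M t n =
        (radixDigit M t' n : ℝ) - radixDigit M t n := by
      unfold cantorDigit; push_cast; ring
    have hgap : (cantorDigit M t n : ℝ) * engelTail (cantorDigit M t') (n + 1) ≤
        1 - 1 / (2 * n + 4) := by
      have h1 := engelTail_le hs' (two_le_cantorDigit h2 t') (n + 1)
      have h3 := cantorDigit_mul_lt hM h2 t t' n
      have h4 := two_le_cantorDigit h2 t' (n + 1)
      have h4' : (2 : ℝ) ≤ cantorDigit M t' (n + 1) := by exact_mod_cast h4
      have h3' : (cantorDigit M t n : ℝ) * (2 * n + 4) ≤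
          (2 * n + 3) * (cantorDigit M t' (n + 1) - 1) := by
        have h5 : ((cantorDigit M t' (n + 1) - 1 : ℕ) : ℝ) = cantorDigit M t' (n + 1) - 1 := by
          rw [Nat.cast_sub (by omega), Nat.cast_one]
        rw [← h5]
        exact_mod_cast h3
      calc _ ≤ (cantorDigit M t n : ℝ) * (1 / (cantorDigit M t' (n + 1) - 1)) := by gcongr
        _ ≤ (2 * n + 3) / (2 * n + 4) := by
            rw [mul_one_div, div_le_div_iff₀ (by linarith) (by positivity)]
            exact h3'
        _ = _ := by field_simp; ring
    have hsep := sub_engelTail_ge hs (two_le_cantorDigit h2 t) hs' (two_le_cantorDigit h2 t')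
      hgap (by unfold cantorDigit; omega) (by rw [div_le_one (by positivity)]; linarith)
    rw [hdiff] at hsep
    have hpos : ∀ (r : ℝ) (j : ℕ), (0 : ℝ) < cantorDigit M r j := fun r j => by
      have := two_le_cantorDigit h2 r j
      positivity
    have hle : ∀ (r : ℝ) (j : ℕ), (cantorDigit M r j : ℝ) ≤ (2 * j + 3) * M j := fun r j => by
      exact_mod_cast cantorDigit_le h2 r j
    have hprod : ∏ j ∈ Finset.range n, (cantorDigit M t j : ℝ) ≤
        (∏ j ∈ Finset.range n, (2 * (j : ℝ) + 3)) * radixProd M n := by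
      rw [radixProd, Nat.cast_prod, ← Finset.prod_mul_distrib]
      exact Finset.prod_le_prod (fun j _ => (hpos t j).le) fun j _ => hle t j
    have hprod0 : 0 < ∏ j ∈ Finset.range n, (cantorDigit M t j : ℝ) :=
      Finset.prod_pos fun j _ => hpos t j
    have hd1 := hpos t n
    have hd2 := hpos t' n
    have hq0 : 0 < ∏ j ∈ Finset.range n, (2 * (j : ℝ) + 3) := Finset.prod_pos fun j _ => by positivity
    calc _ = 1 / (2 * n + 4) * ((radixDigit M t' n : ℝ) - radixDigit M t n) /
          (((2 * n + 3) * M n) * ((2 * n + 3) * M n)) /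
            ((∏ j ∈ Finset.range n, (2 * (j : ℝ) + 3)) * radixProd M n) := by
          unfold separationLoss
          field_simp
      _ ≤ 1 / (2 * n + 4) * ((radixDigit M t' n : ℝ) - radixDigit M t n) /
          (cantorDigit M t n * cantorDigit M t' n) /
            ∏ j ∈ Finset.range n, (cantorDigit M t j : ℝ) := by
          gcongr
          · exact hle t n
          · exact hle t' n
      _ ≤ _ := by gcongr

/-- Combines the separation with `u ≤ u ^ s`, valid since `u ≤ 1` and `s ≤ 1`; `hC` compares the
scales. -/
theorem sub_le_cantorPoint_rpow {s C : ℝ} (hs0 : 0 < s) (hs1 : s ≤ 1)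
    (hC : ∀ n, (radixProd M n * separationLoss n * M n : ℝ) ^ s ≤ C * radixProd M n)
    {t t' : ℝ} (ht : t ∈ Ico (0 : ℝ) 1) (ht' : t' ∈ Ico (0 : ℝ) 1) (hlt : t < t') :
    t' - t ≤ 2 * C * (cantorPoint M t - cantorPoint M t') ^ s := by
  obtain ⟨n, u, hu0, hu1, hdist, hsep⟩ := exists_cantorPoint_separation hM h2 ht ht' hlt
  have hMpos : (0 : ℝ) < M n := by have := h2 n; positivity
  have hPpos : (0 : ℝ) < radixProd M n := by exact_mod_cast radixProd_pos h2 n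
  have hR := separationLoss_pos n
  have hX : (0 : ℝ) < radixProd M n * separationLoss n * M n := by positivity
  have hXs : (0 : ℝ) < (radixProd M n * separationLoss n * M n : ℝ) ^ s := by positivity
  have hC0 : 0 < C := by
    have := hXs.trans_le (hC n)
    exact pos_of_mul_pos_left this hPpos.le
  calc t' - t ≤ 2 * (u / radixProd M n) := hdist
    _ ≤ 2 * (u ^ s / radixProd M n) := by
        gcongr
        simpa using Real.rpow_le_rpow_of_exponent_ge hu0 hu1 hs1
    _ ≤ 2 * (C * (u ^ s / (radixProd M n * separationLoss n * M n) ^ s)) := by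
        gcongr
        rw [mul_div_assoc', div_le_div_iff₀ hPpos hXs]
        have := mul_le_mul_of_nonneg_left (hC n) (Real.rpow_nonneg hu0.le s)
        linarith
    _ = 2 * C * (u / (radixProd M n * separationLoss n * M n)) ^ s := by
        rw [Real.div_rpow hu0.le hX.le]
        ring
    _ ≤ _ := by gcongr

/-- The Cantor set has dimension at least `s` if its parametrization has an `s`-Hölder inverse. -/
theorem le_dimH_image_cantorPoint {s : NNReal} {C : ℝ} (hs0 : 0 < s) (hs1 : s ≤ 1)
    (hC : ∀ n, (radixProd M n * separationLoss n * M n : ℝ) ^ (s : ℝ) ≤ C * radixProd M n) :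
    (s : ℝ≥0∞) ≤ dimH (cantorPoint M '' Ico 0 1) := by
  have hs0' : (0 : ℝ) < s := by exact_mod_cast hs0
  have hs1' : (s : ℝ) ≤ 1 := by exact_mod_cast hs1
  have hdist : ∀ t ∈ Ico (0 : ℝ) 1, ∀ t' ∈ Ico (0 : ℝ) 1,
      dist t t' ≤ 2 * C * dist (cantorPoint M t) (cantorPoint M t') ^ (s : ℝ) := by
    have hlt : ∀ t ∈ Ico (0 : ℝ) 1, ∀ t' ∈ Ico (0 : ℝ) 1, t < t' →
        dist t t' ≤ 2 * C * dist (cantorPoint M t) (cantorPoint M t') ^ (s : ℝ) := by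
      intro t ht t' ht' hlt
      obtain ⟨n, u, hu0, -, -, hsep⟩ := exists_cantorPoint_separation hM h2 ht ht' hlt
      have hpos : 0 ≤ cantorPoint M t - cantorPoint M t' := by
        refine le_trans ?_ hsep
        have := (separationLoss_pos n).le
        positivity
      rw [dist_comm t t', Real.dist_eq, Real.dist_eq, abs_of_pos (sub_pos.2 hlt),
        abs_of_nonneg hpos]
      exact sub_le_cantorPoint_rpow hM h2 hs0' hs1' hC ht ht' hlt
    intro t ht t' ht'
    rcases lt_trichotomy t t' with h | rfl | h
    · exact hlt t ht t' ht' h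
    · simp [Real.zero_rpow hs0'.ne']
    · rw [dist_comm t, dist_comm (cantorPoint M t)]
      exact hlt t' ht' t ht h
  have hinj : InjOn (cantorPoint M) (Ico 0 1) := fun t ht t' ht' h => by
    have := hdist t ht t' ht'
    rw [h, dist_self, Real.zero_rpow hs0'.ne', mul_zero] at this
    exact dist_le_zero.1 this
  have hleft := hinj.leftInvOn_invFunOn
  have hhol : HolderOnWith (2 * C).toNNReal s (Function.invFunOn (cantorPoint M) (Ico 0 1))
      (cantorPoint M '' Ico 0 1) := by
    rintro _ ⟨t, ht, rfl⟩ _ ⟨t', ht', rfl⟩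
    rw [hleft ht, hleft ht', edist_dist, edist_dist,
      ENNReal.ofReal_rpow_of_nonneg dist_nonneg hs0'.le]
    change _ ≤ ENNReal.ofReal (2 * C) * _
    rw [← ENNReal.ofReal_mul' (by positivity)]
    exact ENNReal.ofReal_le_ofReal (hdist t ht t' ht')
  -- The Hölder inverse maps the Cantor set onto `[0,1)`, of dimension 1, so `1 ≤ dim / s`.
  have hdim := hhol.dimH_image_le hs0
  rw [hleft.image_image] at hdim
  have hone : dimH (Ico (0 : ℝ) 1) = 1 := by
    rw [Real.dimH_of_nonempty_interior (by simp [interior_Ico])]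
    simp
  rw [hone, ENNReal.le_div_iff_mul_le (by simp [hs0.ne']) (by simp), one_mul] at hdim
  exact hdim

end mixedRadix

/-! ### Regularized growth and the Hölder condition. -/

/-- Regularization of a sequence growing slower than `B ^ n`: its smallest majorant whose growth
ratio is at most `B`. -/
theorem exists_regularized_majorant {ψ : ℕ → ℝ} (hmono : Monotone ψ) (hpos : ∀ n, 0 < ψ n)
    {B' B C : ℝ} (hB' : 1 < B') (hBB : B' < B) (hC : 0 ≤ C) (hψ : ∀ n, ψ n ≤ C * B' ^ n) :
    ∃ L : ℕ → ℝ, Monotone L ∧ (∀ n, ψ n ≤ L n) ∧ (∀ n, L (n + 1) ≤ B * L n) ∧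
      ∃ᶠ n in atTop, L n = ψ n := by
  have hB0 : 0 < B := by linarith
  have hle : ∀ n i, ψ (n + i) / B ^ i ≤ C * B' ^ n := fun n i => by
    rw [div_le_iff₀ (by positivity)]
    calc ψ (n + i) ≤ C * B' ^ (n + i) := hψ _
      _ = C * B' ^ n * B' ^ i := by ring
      _ ≤ _ := by gcongr
  have hbdd : ∀ n, BddAbove (range fun i => ψ (n + i) / B ^ i) := fun n =>
    ⟨C * B' ^ n, by rintro _ ⟨i, rfl⟩; exact hle n i⟩
  set L : ℕ → ℝ := fun n => ⨆ i, ψ (n + i) / B ^ i with hL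
  have hLψ : ∀ n, ψ n ≤ L n := fun n => by simpa using le_ciSup (hbdd n) 0
  -- Split the supremum into its term `i = 0` and the rest, which is `L (n + 1) / B`.
  have hstep : ∀ n, L n ≤ max (ψ n) (L (n + 1) / B) := fun n => by
    refine ciSup_le fun i => ?_
    cases i with
    | zero => simp
    | succ i =>
      refine le_max_of_le_right ?_
      rw [pow_succ, ← div_div]
      have := le_ciSup (hbdd (n + 1)) i
      rw [add_right_comm, add_assoc] at this
      exact div_le_div_of_nonneg_right this hB0.le
  refine ⟨L, fun m n hmn => ?_, hLψ, fun n => ?_, ?_⟩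
  · refine ciSup_mono (hbdd n) fun i => ?_
    gcongr
    exact hmono (by omega)
  · refine ciSup_le fun i => ?_
    have := le_ciSup (hbdd n) (i + 1)
    calc ψ (n + 1 + i) / B ^ i = B * (ψ (n + (i + 1)) / B ^ (i + 1)) := by
          rw [show n + 1 + i = n + (i + 1) by ring, pow_succ]
          field_simp
      _ ≤ _ := by gcongr
  -- Were `L` above `ψ` from `N` on, it would grow there at least like `B ^ k`, contradicting `L n ≤
  -- C * B' ^ n` with `B' < B`.
  · intro hne
    obtain ⟨N, hN⟩ := eventually_atTop.1 hne
    have hgeo : ∀ k, B ^ k * L N ≤ L (N + k) := fun k => by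
      induction k with
      | zero => simp
      | succ k ih =>
        have hlt : ψ (N + k) < L (N + k) :=
          lt_of_le_of_ne (hLψ _) (Ne.symm (hN (N + k) (by omega)))
        have h1 : L (N + k) ≤ L (N + k + 1) / B :=
          (le_max_iff.1 (hstep (N + k))).resolve_left (not_le.2 hlt)
        rw [le_div_iff₀ hB0] at h1
        calc B ^ (k + 1) * L N = B ^ k * L N * B := by ring
          _ ≤ L (N + k) * B := by gcongr
          _ ≤ _ := h1
    have hLN : 0 < L N := (hpos N).trans_le (hLψ N)
    have hr : Tendsto (fun k : ℕ => C * B' ^ N * (B' / B) ^ k) atTop (𝓝 0) := by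
      simpa using (tendsto_pow_atTop_nhds_zero_of_lt_one (by positivity)
        ((div_lt_one hB0).2 hBB)).const_mul (C * B' ^ N)
    obtain ⟨k, hk⟩ := (hr.eventually_lt_const hLN).exists
    have h1 : L (N + k) ≤ C * B' ^ (N + k) := ciSup_le fun i => hle (N + k) i
    have h3 : L N ≤ C * B' ^ N * (B' / B) ^ k := by
      rw [div_pow, mul_div_assoc', le_div_iff₀ (by positivity)]
      calc L N * B ^ k ≤ L (N + k) := by rw [mul_comm]; exact hgeo k
        _ ≤ _ := h1
        _ = _ := by ring
    linarith

/-- Telescoping of `L (n + 1) - L n ≤ (B - 1) * L n`. -/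
theorem le_sub_one_mul_sum_add {L : ℕ → ℝ} {B : ℝ} (h : ∀ n, L (n + 1) ≤ B * L n) (n : ℕ) :
    L n ≤ (B - 1) * ∑ j ∈ Finset.range n, L j + L 0 := by
  induction n with
  | zero => simp
  | succ n ih =>
    rw [Finset.sum_range_succ]
    linarith [h n]

theorem exists_sum_range_le {f : ℕ → ℝ} (h : ∀ᶠ n in atTop, f n ≤ 0) :
    ∃ c, ∀ n, ∑ j ∈ Finset.range n, f j ≤ c := by
  obtain ⟨N, hN⟩ := eventually_atTop.1 h
  refine ⟨∑ j ∈ Finset.range N, max (f j) 0, fun n => ?_⟩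
  calc ∑ j ∈ Finset.range n, f j ≤ ∑ j ∈ Finset.range n, if j < N then max (f j) 0 else 0 := by
        refine Finset.sum_le_sum fun j _ => ?_
        split_ifs with hj
        · exact le_max_left _ _
        · exact hN j (not_lt.1 hj)
    _ ≤ ∑ j ∈ Finset.range (n + N), if j < N then max (f j) 0 else 0 := by
        refine Finset.sum_le_sum_of_subset_of_nonneg (by gcongr; omega) fun j _ _ => ?_
        split_ifs <;> simp
    _ = _ := by
        rw [← Finset.sum_filter]
        congr 1
        ext j
        simp only [Finset.mem_filter, Finset.mem_range]
        omega

/-- The value at 0 is 36, and each step multiplies by at most `(2n + 6) ^ 4`. The sum form allows a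
termwise comparison with `L`. -/
theorem log_separationLoss_le (n : ℕ) :
    Real.log (separationLoss n) ≤
      Real.log 36 + ∑ j ∈ Finset.range n, 4 * Real.log (2 * (j : ℝ) + 6) := by
  induction n with
  | zero => simp [separationLoss]; norm_num
  | succ n ih =>
    have hp : (0 : ℝ) < ∏ j ∈ Finset.range n, (2 * (j : ℝ) + 3) :=
      Finset.prod_pos fun j _ => by positivity
    have hstep : separationLoss (n + 1) ≤ separationLoss n * (2 * (n : ℝ) + 6) ^ 4 := by
      unfold separationLoss
      rw [Finset.prod_range_succ]
      push_cast
      calc _ = (∏ j ∈ Finset.range n, (2 * (j : ℝ) + 3)) * 1 *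
            ((2 * (n : ℝ) + 6) * (2 * n + 5) * (2 * n + 5) * (2 * n + 3)) := by ring
        _ ≤ (∏ j ∈ Finset.range n, (2 * (j : ℝ) + 3)) * ((2 * n + 4) * (2 * n + 3) ^ 2) *
            ((2 * (n : ℝ) + 6) * (2 * n + 6) * (2 * n + 6) * (2 * n + 6)) := by
            gcongr
            · have h0 : (0 : ℝ) ≤ n := by positivity
              exact one_le_mul_of_one_le_of_one_le (by linarith)
                (one_le_pow₀ (by linarith))
            · norm_num
            · norm_num
            · norm_num
        _ = _ := by ring
    have hlog := Real.log_le_log (separationLoss_pos (n + 1)) hstep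
    rw [Real.log_mul (separationLoss_pos n).ne' (by positivity), Real.log_pow] at hlog
    rw [Finset.sum_range_succ]
    push_cast at hlog
    linarith

/-- The block lengths associated with a growth sequence `L`. -/
noncomputable def blockLength (L : ℕ → ℝ) (n : ℕ) : ℕ := ⌈Real.exp (L n)⌉₊ + 1

theorem two_le_blockLength (L : ℕ → ℝ) (n : ℕ) : 2 ≤ blockLength L n := by
  have : 0 < ⌈Real.exp (L n)⌉₊ := Nat.ceil_pos.2 (Real.exp_pos _)
  unfold blockLength
  omega

theorem monotone_blockLength {L : ℕ → ℝ} (hL : Monotone L) : Monotone (blockLength L) :=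
  fun m n h => by
    unfold blockLength
    gcongr
    exact hL h

theorem le_log_blockLength (L : ℕ → ℝ) (n : ℕ) : L n ≤ Real.log (blockLength L n) := by
  have h := two_le_blockLength L n
  rw [Real.le_log_iff_exp_le (by positivity)]
  have := Nat.le_ceil (Real.exp (L n))
  unfold blockLength
  push_cast
  linarith

theorem log_blockLength_le {L : ℕ → ℝ} {n : ℕ} (h0 : 0 ≤ L n) :
    Real.log (blockLength L n) ≤ L n + Real.log 3 := by
  have h := two_le_blockLength L n
  have h1 := Nat.ceil_lt_add_one (Real.exp_pos (L n)).le
  have h3 := Real.one_le_exp h0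
  rw [Real.log_le_iff_le_exp (by positivity), Real.exp_add, Real.exp_log (by norm_num)]
  unfold blockLength
  push_cast
  linarith

/-- In logarithms, up to constants, the claim is `s (B ∑ L j + log separationLoss) ≤ ∑ L j`. By
`hlog` the loss fits termwise into the slack `(1 - s B) L j` for all but finitely many `j`, and
these go into `C`. -/
theorem exists_rpow_le_radixProd {L : ℕ → ℝ} (hL0 : ∀ n, 0 ≤ L n) {B s : ℝ}
    (hs0 : 0 ≤ s) (hs1 : s ≤ 1) (hstep : ∀ n, L (n + 1) ≤ B * L n)
    (hlog : ∀ᶠ n : ℕ in atTop, 4 * s * Real.log (2 * n + 6) ≤ (1 - s * B) * L n) :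
    ∃ C : ℝ, ∀ n, (radixProd (blockLength L) n * separationLoss n * blockLength L n : ℝ) ^ s ≤
      C * radixProd (blockLength L) n := by
  obtain ⟨c, hc⟩ := exists_sum_range_le
    (f := fun n : ℕ => 4 * s * Real.log (2 * n + 6) - (1 - s * B) * L n)
    (hlog.mono fun n hn => by linarith)
  refine ⟨Real.exp (c + s * (L 0 + Real.log 3 + Real.log 36)), fun n => ?_⟩
  have h2 := two_le_blockLength L
  have hP : (0 : ℝ) < radixProd (blockLength L) n := by exact_mod_cast radixProd_pos h2 n
  have hM : (0 : ℝ) < blockLength L n := by have := h2 n; positivity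
  have hR := separationLoss_pos n
  have hPlog : ∑ j ∈ Finset.range n, L j ≤ Real.log (radixProd (blockLength L) n) := by
    rw [radixProd, Nat.cast_prod, Real.log_prod fun j _ => by have := h2 j; positivity]
    exact Finset.sum_le_sum fun j _ => le_log_blockLength L j
  have hMlog := log_blockLength_le (hL0 n)
  have hRlog := log_separationLoss_le n
  have hLsum := le_sub_one_mul_sum_add hstep n
  have hcn := hc n
  rw [Finset.sum_sub_distrib, ← Finset.mul_sum, ← Finset.mul_sum] at hcn
  rw [← Finset.mul_sum] at hRlog
  rw [← Real.log_le_log_iff (by positivity) (by positivity), Real.log_rpow (by positivity),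
    Real.log_mul (by positivity) hM.ne', Real.log_mul hP.ne' hR.ne',
    Real.log_mul (by positivity) hP.ne', Real.log_exp]
  have h5 := mul_le_mul_of_nonneg_left (add_le_add hRlog (hMlog.trans (add_le_add_left hLsum _))) hs0
  have h6 := mul_le_mul_of_nonneg_left hPlog (sub_nonneg.2 hs1)
  linarith

theorem eventually_mul_log_le {φ : ℕ → ℝ}
    (hgrowth : Tendsto (fun n : ℕ => φ n / Real.log (n : ℝ)) atTop atTop) {K : ℝ} (hK : 0 ≤ K) :
    ∀ᶠ n : ℕ in atTop, K * Real.log (2 * n + 6) ≤ φ (n + 1) := by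
  filter_upwards [(tendsto_add_atTop_nat 1).eventually (hgrowth.eventually_ge_atTop (K * 4)),
    eventually_ge_atTop 1] with n hn hn1
  have hn1' : (1 : ℝ) ≤ n := by exact_mod_cast hn1
  have hlog : 0 < Real.log ((n + 1 : ℕ) : ℝ) := Real.log_pos (by push_cast; linarith)
  rw [le_div_iff₀ hlog] at hn
  refine le_trans ?_ hn
  rw [mul_assoc]
  refine mul_le_mul_of_nonneg_left ?_ hK
  -- The 4 comes from `2n + 6 ≤ (n + 1) ^ 4` for `n ≥ 1`.
  rw [show (4 : ℝ) = ((4 : ℕ) : ℝ) by norm_num, ← Real.log_pow]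
  refine Real.log_le_log (by positivity) ?_
  push_cast
  nlinarith [sq_nonneg ((n : ℝ) ^ 2), pow_nonneg (zero_le_one.trans hn1') 3]

theorem le_log_cantorDigit (L : ℕ → ℝ) (t : ℝ) (n : ℕ) :
    L n ≤ Real.log (cantorDigit (blockLength L) t n) := by
  refine (le_log_blockLength L n).trans ?_
  have := two_le_blockLength L n
  refine Real.log_le_log (by positivity) ?_
  norm_cast
  unfold cantorDigit
  nlinarith [Nat.zero_le (n * blockLength L n)]

theorem log_cantorDigit_le {L : ℕ → ℝ} (t : ℝ) {n : ℕ} (h0 : 0 ≤ L n) :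
    Real.log (cantorDigit (blockLength L) t n) ≤ L n + 2 * Real.log (2 * n + 6) := by
  have h2 := two_le_blockLength L
  have hd := two_le_cantorDigit h2 t n
  have hM : (0 : ℝ) < blockLength L n := by have := h2 n; positivity
  have hle : (cantorDigit (blockLength L) t n : ℝ) ≤ (2 * n + 3) * blockLength L n := by
    exact_mod_cast cantorDigit_le h2 t n
  have h1 := Real.log_le_log (by positivity) hle
  rw [Real.log_mul (by positivity) hM.ne'] at h1
  have h3 : Real.log (2 * (n : ℝ) + 3) ≤ Real.log (2 * n + 6) :=
    Real.log_le_log (by positivity) (by linarith)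
  have h4 : Real.log 3 ≤ Real.log (2 * n + 6) :=
    Real.log_le_log (by positivity) (by linarith [(Nat.cast_nonneg n : (0 : ℝ) ≤ n)])
  linarith [log_blockLength_le h0]

theorem cantorPoint_mem_engelGrowthSet {φ L : ℕ → ℝ} (hpos : ∀ n : ℕ, 1 ≤ n → 0 < φ n)
    (hgrowth : Tendsto (fun n : ℕ => φ n / Real.log (n : ℝ)) atTop atTop)
    (hL : Monotone L) (hφL : ∀ n, φ (n + 1) ≤ L n) (hfreq : ∃ᶠ n in atTop, L n = φ (n + 1))
    (t : ℝ) : cantorPoint (blockLength L) t ∈ engelGrowthSet φ := by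
  have hs := strictMono_cantorDigit (monotone_blockLength hL) (two_le_blockLength L) t
  have h2 := two_le_cantorDigit (two_le_blockLength L) t
  have hφ : ∀ n, 0 < φ (n + 1) := fun n => hpos _ (by omega)
  refine ⟨engelTail_mem_Ioo hs h2, hasInfiniteEngelExpansion_engelTail hs h2, ?_⟩
  rw [← liminf_nat_add _ 1]
  simp only [cantorPoint, engelDigit_engelTail hs h2]
  apply le_antisymm
  · refine le_of_forall_gt_imp_ge_of_dense fun c hc => ?_
    obtain ⟨r, hr, hrc⟩ := EReal.lt_iff_exists_real_btwn.1 hc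
    have hr1 : 1 < r := by exact_mod_cast hr
    refine le_trans (liminf_le_of_frequently_le' ?_) hrc.le
    -- Where `L n = φ (n + 1)`, the digit has logarithm at most `φ (n + 1) + 2 log (2n + 6)`; this
    -- `K` makes the error at most `(r - 1) φ (n + 1)`.
    have hev := eventually_mul_log_le hgrowth (K := 2 / (r - 1))
      (div_nonneg (by norm_num) (by linarith))
    refine (hfreq.and_eventually hev).mono fun n ⟨hn, hn'⟩ => ?_
    rw [EReal.coe_le_coe_iff, div_le_iff₀ (hφ n)]
    have h3 := log_cantorDigit_le (L := L) t (n := n) (by rw [hn]; exact (hφ n).le)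
    rw [div_mul_eq_mul_div, div_le_iff₀ (by linarith)] at hn'
    linarith
  · refine le_liminf_of_le (h := Eventually.of_forall fun n => ?_)
    rw [← EReal.coe_one, EReal.coe_le_coe_iff, le_div_iff₀ (hφ n), one_mul]
    exact (hφL n).trans (le_log_cantorDigit L t n)

/-! ### From the exponent `A` to the two bounds. -/

theorem exists_forall_le_mul_pow {ψ : ℕ → ℝ} (hpos : ∀ n, 0 ≤ ψ n) {B : ℝ} (hB : 1 ≤ B)
    (h : ∀ᶠ n in atTop, ψ n ≤ B * B ^ n) : ∃ C, 0 ≤ C ∧ ∀ n, ψ n ≤ C * B ^ n := by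
  obtain ⟨N, hN⟩ := eventually_atTop.1 h
  have hS : 0 ≤ ∑ j ∈ Finset.range N, ψ j := Finset.sum_nonneg fun j _ => hpos j
  refine ⟨B + ∑ j ∈ Finset.range N, ψ j, by linarith, fun n => ?_⟩
  have hBn : 1 ≤ B ^ n := one_le_pow₀ hB
  rcases le_or_gt N n with hn | hn
  · nlinarith [hN n hn]
  · have := Finset.single_le_sum (f := ψ) (fun j _ => hpos j) (Finset.mem_range.2 hn)
    nlinarith

theorem eventually_le_pow_of_lt {φ : ℕ → ℝ} (hpos : ∀ n : ℕ, 1 ≤ n → 0 < φ n) {A : ℝ≥0∞}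
    (hA : ENNReal.log A =
      limsup (fun n : ℕ => ((Real.log (φ n) / (n : ℝ) : ℝ) : EReal)) atTop)
    {B : ℝ} (hB : 0 < B) (hAB : A < ENNReal.ofReal B) : ∀ᶠ n in atTop, φ n ≤ B ^ n := by
  have h := ENNReal.log_lt_log hAB
  rw [hA, ENNReal.log_ofReal_of_pos hB] at h
  filter_upwards [eventually_lt_of_limsup_lt h, eventually_ge_atTop 1] with n hn hn1
  have hn0 : (0 : ℝ) < n := by exact_mod_cast hn1
  rw [EReal.coe_lt_coe_iff, div_lt_iff₀ hn0, mul_comm, ← Real.log_pow] at hn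
  exact ((Real.log_lt_log_iff (hpos n hn1) (by positivity)).1 hn).le

theorem frequently_pow_le_of_lt {φ : ℕ → ℝ} (hpos : ∀ n : ℕ, 1 ≤ n → 0 < φ n) {A : ℝ≥0∞}
    (hA : ENNReal.log A =
      limsup (fun n : ℕ => ((Real.log (φ n) / (n : ℝ) : ℝ) : EReal)) atTop)
    {B : ℝ} (hB : 0 < B) (hAB : ENNReal.ofReal B < A) : ∃ᶠ n in atTop, B ^ n ≤ φ n := by
  have h := ENNReal.log_lt_log hAB
  rw [hA, ENNReal.log_ofReal_of_pos hB] at h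
  refine ((frequently_lt_of_lt_limsup (by isBoundedDefault) h).and_eventually
    (eventually_ge_atTop 1)).mono fun n ⟨hn, hn1⟩ => ?_
  have hn0 : (0 : ℝ) < n := by exact_mod_cast hn1
  rw [EReal.coe_lt_coe_iff, lt_div_iff₀ hn0, mul_comm, ← Real.log_pow] at hn
  exact ((Real.log_lt_log_iff (by positivity) (hpos n hn1)).1 hn).le

theorem engelGrowthSet_subset_fastEngelSet {φ : ℕ → ℝ} (hpos : ∀ n : ℕ, 1 ≤ n → 0 < φ n)
    {B B' : ℝ} (hB : 1 ≤ B) (hBB : B < B') (hfreq : ∃ᶠ n in atTop, B' ^ n ≤ φ n) :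
    engelGrowthSet φ ⊆ fastEngelSet B := by
  rintro x ⟨hx, hinf, hlim⟩
  refine ⟨hx, hinf, fun K => ?_⟩
  have hB0 : 0 < B := by linarith
  have hB'0 : 0 < B' := by linarith
  -- Any positive constant below 1 would do; the strict inequality `B < B'` absorbs it together with
  -- `K`.
  have hhalf : ((1 / 2 : ℝ) : EReal) <
      liminf (fun n : ℕ => ((Real.log (engelDigit x n : ℝ) / φ n : ℝ) : EReal)) atTop := by
    rw [hlim, ← EReal.coe_one, EReal.coe_lt_coe_iff]
    norm_num
  have hr : Tendsto (fun k : ℕ => |K| * (B / B') ^ k) atTop (𝓝 0) := by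
    simpa using (tendsto_pow_atTop_nhds_zero_of_lt_one (by positivity)
      ((div_lt_one hB'0).2 hBB)).const_mul |K|
  obtain ⟨n, hn, hlt, hK, hn1⟩ := (hfreq.and_eventually
    ((eventually_lt_of_lt_liminf hhalf (by isBoundedDefault)).and
      ((hr.eventually_lt_const (show (0 : ℝ) < 1 / 2 by norm_num)).and
        (eventually_ge_atTop 1)))).exists
  obtain ⟨m, rfl⟩ : ∃ m, n = m + 1 := ⟨n - 1, by omega⟩
  refine ⟨m, ?_⟩
  rw [EReal.coe_lt_coe_iff, lt_div_iff₀ (hpos _ hn1)] at hlt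
  rw [div_pow, mul_div_assoc', div_lt_iff₀ (by positivity)] at hK
  calc K * B ^ m ≤ |K| * B ^ (m + 1) := by
        gcongr
        · exact le_abs_self K
        · omega
    _ ≤ _ := by linarith

/-- Growth beyond `log n` forces `φ ≥ 1` eventually. The bound `1 ≤ A` keeps the Hölder exponents at
most 1 and the growth bases above 1. -/
theorem one_le_of_log_eq_limsup {φ : ℕ → ℝ}
    (hgrowth : Tendsto (fun n : ℕ => φ n / Real.log (n : ℝ)) atTop atTop) {A : ℝ≥0∞}
    (hA : ENNReal.log A =
      limsup (fun n : ℕ => ((Real.log (φ n) / (n : ℝ) : ℝ) : EReal)) atTop) : 1 ≤ A := by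
  rw [← ENNReal.log_le_log_iff, ENNReal.log_one, hA, ← limsup_nat_add _ 1]
  refine le_limsup_of_frequently_le' (Eventually.frequently ?_)
  have hev := eventually_mul_log_le hgrowth (K := 1 / Real.log 6)
    (one_div_nonneg.2 (Real.log_nonneg (by norm_num)))
  filter_upwards [hev] with n hn
  have h6 : 0 < Real.log 6 := Real.log_pos (by norm_num)
  have h7 : Real.log 6 ≤ Real.log (2 * n + 6) :=
    Real.log_le_log (by norm_num) (by linarith [(Nat.cast_nonneg n : (0 : ℝ) ≤ n)])
  have h1 : 1 ≤ φ (n + 1) := by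
    refine le_trans ?_ hn
    rw [div_mul_eq_mul_div, one_mul, le_div_iff₀ h6]
    linarith
  exact_mod_cast div_nonneg (Real.log_nonneg h1) (Nat.cast_nonneg _)

theorem dimH_engelGrowthSet_le {φ : ℕ → ℝ} (hpos : ∀ n : ℕ, 1 ≤ n → 0 < φ n) {A : ℝ≥0∞}
    (hA : ENNReal.log A =
      limsup (fun n : ℕ => ((Real.log (φ n) / (n : ℝ) : ℝ) : EReal)) atTop) :
    dimH (engelGrowthSet φ) ≤ A⁻¹ := by
  refine le_of_forall_gt_imp_ge_of_dense fun c hc => ?_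
  -- For `c ≥ 1` the dimension of the line suffices; otherwise `c⁻¹ > 1` leaves room for bases `1 <
  -- B < B' < A`.
  rcases le_or_gt 1 c with h1 | h1
  · refine le_trans ?_ h1
    exact (dimH_mono (subset_univ _)).trans Real.dimH_univ.le
  have hcA : c⁻¹ < A := ENNReal.inv_lt_iff_inv_lt.1 hc
  obtain ⟨B, hcB, hBA⟩ := ENNReal.lt_iff_exists_nnreal_btwn.1 hcA
  obtain ⟨B', hBB', hBA'⟩ := ENNReal.lt_iff_exists_nnreal_btwn.1 hBA
  have hB1 : (1 : ℝ) < B := by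
    have : (1 : ℝ≥0∞) < B := (ENNReal.one_lt_inv.2 h1).trans hcB
    exact_mod_cast this
  have hBB : (B : ℝ) < B' := by exact_mod_cast hBB'
  have hfreq := frequently_pow_le_of_lt hpos hA (B := B') (by linarith)
    (by rwa [ENNReal.ofReal_coe_nnreal])
  refine (dimH_mono (engelGrowthSet_subset_fastEngelSet hpos hB1.le hBB hfreq)).trans ?_
  refine (dimH_fastEngelSet_le hB1).trans ?_
  rw [one_div, ENNReal.ofReal_inv_of_pos (by linarith), ENNReal.ofReal_coe_nnreal]
  exact (ENNReal.inv_lt_iff_inv_lt.1 hcB).le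

theorem le_dimH_engelGrowthSet {φ : ℕ → ℝ} (hpos : ∀ n : ℕ, 1 ≤ n → 0 < φ n)
    (hmono : MonotoneOn φ (Set.Ici 1))
    (hgrowth : Tendsto (fun n : ℕ => φ n / Real.log (n : ℝ)) atTop atTop) {A : ℝ≥0∞}
    (hA : ENNReal.log A =
      limsup (fun n : ℕ => ((Real.log (φ n) / (n : ℝ) : ℝ) : EReal)) atTop) :
    A⁻¹ ≤ dimH (engelGrowthSet φ) := by
  have hA1 := one_le_of_log_eq_limsup hgrowth hA
  refine le_of_forall_lt_imp_le_of_dense fun c hc => ?_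
  obtain ⟨s, hcs, hsA⟩ := ENNReal.lt_iff_exists_nnreal_btwn.1 hc
  have hs0 : 0 < s := by
    have : (0 : ℝ≥0∞) < s := bot_le.trans_lt hcs
    exact_mod_cast this
  have hs0' : (0 : ℝ) < s := by exact_mod_cast hs0
  have hs1 : s ≤ 1 := by
    have : (s : ℝ≥0∞) ≤ 1 := hsA.le.trans (ENNReal.inv_le_one.2 hA1)
    exact_mod_cast this
  have hAs : A < ((s⁻¹ : NNReal) : ℝ≥0∞) := by
    rw [ENNReal.coe_inv hs0.ne']
    exact ENNReal.lt_inv_iff_lt_inv.1 hsA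
  -- In `A < B' < B < 1/s`, `B'` bounds the growth of `φ`, `B` the ratio of the majorant, and `s * B
  -- < 1` leaves the slack for the separation loss.
  obtain ⟨B', hAB', hB's⟩ := ENNReal.lt_iff_exists_nnreal_btwn.1 hAs
  obtain ⟨B, hB'B, hBs⟩ := ENNReal.lt_iff_exists_nnreal_btwn.1 hB's
  have hB'1 : (1 : ℝ) < B' := by
    have : (1 : ℝ≥0∞) < B' := hA1.trans_lt hAB'
    exact_mod_cast this
  have hBB : (B' : ℝ) < B := by exact_mod_cast hB'B
  have hsB : (s : ℝ) * B < 1 := by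
    have : (B : ℝ) < (s : ℝ)⁻¹ := by exact_mod_cast hBs
    rw [lt_inv_comm₀ (by linarith) hs0'] at this
    rwa [← lt_div_iff₀ (by linarith), one_div]
  have hφ : ∀ n, 0 < φ (n + 1) := fun n => hpos _ (by omega)
  have hev := eventually_le_pow_of_lt hpos hA (B := B') (by linarith)
    (by rwa [ENNReal.ofReal_coe_nnreal])
  obtain ⟨C, hC0, hC⟩ := exists_forall_le_mul_pow (ψ := fun n => φ (n + 1))
    (fun n => (hφ n).le) hB'1.le
    (((tendsto_add_atTop_nat 1).eventually hev).mono fun n hn => by rwa [← pow_succ'])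
  obtain ⟨L, hL, hφL, hstep, hfreq⟩ := exists_regularized_majorant (ψ := fun n => φ (n + 1))
    (fun m n hmn => hmono (by simp) (by simp) (by omega)) hφ hB'1 hBB hC0 hC
  have hlog : ∀ᶠ n : ℕ in atTop, 4 * s * Real.log (2 * n + 6) ≤ (1 - s * B) * L n := by
    filter_upwards [eventually_mul_log_le hgrowth (K := 4 * s / (1 - s * B))
      (div_nonneg (by positivity) (by linarith))] with n hn
    rw [div_mul_eq_mul_div, div_le_iff₀ (by linarith)] at hn
    have := mul_le_mul_of_nonneg_left (hφL n) (show 0 ≤ 1 - (s : ℝ) * B by linarith)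
    linarith
  obtain ⟨C', hC'⟩ := exists_rpow_le_radixProd (fun n => (hφ n).le.trans (hφL n)) hs0'.le
    (by exact_mod_cast hs1) hstep hlog
  calc c ≤ s := hcs.le
    _ ≤ dimH (cantorPoint (blockLength L) '' Ico 0 1) :=
        le_dimH_image_cantorPoint (monotone_blockLength hL) (two_le_blockLength L) hs0 hs1 hC'
    _ ≤ _ := dimH_mono (by
        rintro _ ⟨t, -, rfl⟩
        exact cantorPoint_mem_engelGrowthSet hpos hgrowth hL hφL hfreq t)

theorem mainTheorem2 (φ : ℕ → ℝ)
    (hpos : ∀ n : ℕ, 1 ≤ n → 0 < φ n)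
    (hmono : MonotoneOn φ (Set.Ici 1))
    (hgrowth : Tendsto (fun n : ℕ => φ n / Real.log (n : ℝ)) atTop atTop)
    (A : ℝ≥0∞)
    (hA : ENNReal.log A =
      limsup (fun n : ℕ => ((Real.log (φ n) / (n : ℝ) : ℝ) : EReal)) atTop) :
    dimH (engelGrowthSet φ) = 1 / A := by
  rw [one_div]
  exact le_antisymm (dimH_engelGrowthSet_le hpos hA) (le_dimH_engelGrowthSet hpos hmono hgrowth hA)
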